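/- Let $d\ge 1$, let $\lambda\in(0,\infty)$, and let $(\xi_j)_{j\in\mathbb Z}$ be random points of $\mathbb R^d$ such that $\Xi=\sum_{j\in\mathbb Z}\varepsilon_{\xi_j}$ is a homogeneous Poisson process on $\mathbb R^d$ with rate $\lambda$ ($\varepsilon_x$ is the Dirac measure at $x$). Let $\{Y_t,\,t\ge 0\}$ be an arbitrary random process in $\mathbb R^d$ with $Y_0=0$ (the displacement process), and let $\{Y^{(j)}_t,\,t\ge 0\}$, $j\in\mathbb Z$, be independent copies of it; assume that the family $(Y^{(j)})_{j\in\mathbb Z}$ is independent of the sequence $(\xi_j)_{j\in\mathbb Z}$ of initial positions. Let $B\subset\mathbb R^d$ be a compact set with non-empty interior, and let $$N(t)=\sum_{j\in\mathbb Z}\mathbf 1\{\xi_j+Y^{(j)}_t\in B\},\qquad t\ge 0,$$ be the Smoluchowski process. Let $\Pi_n$ denote the set of all non-empty subsets of $\{1,\dots,n\}$, and for $\pi\in\Pi_n$ put $\pi^c=\{1,\dots,n\}\setminus\pi$. Then for all $\theta=(\theta_1,\dots,\theta_n)\in\mathbb R^n$ and all $0\le t_1\le t_2\le\dots\le t_n$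 the variables $N(t_1),\dots,N(t_n)$ are almost surely finite, the expectation and the integrals below are finite, and $$\ln \mathbb E\exp\Big\{\sum_{k=1}^n\theta_kN(t_k)\Big\}=\lambda\sum_{\pi\in\Pi_n}\Big[e^{\sum_{k\in\pi}\theta_k}-1\Big]\,\bar Q_\pi(t_1,\dots,t_n),$$ where $$\bar Q_\pi(t_1,\dots,t_n)=\int_{\mathbb R^d}Q_\pi(x;t_1,\dots,t_n)\,dx,$$ $$Q_\pi(x;t_1,\dots,t_n)=\mathbb P\big\{x+Y_{t_k}\in B\ \text{for all } k\in\pi,\ \text{and}\ x+Y_{t_k}\notin B\ \text{for all } k\in\pi^c\big\}.$$ -/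

import Mathlib

open MeasureTheory ProbabilityTheory
open scoped NNReal ENNReal

namespace Smoluchowski

noncomputable section

/-- A random measure `Ξ` on `E`, defined on the probability space `(Ω, P)`, is a Poisson process
with intensity measure `ν`: for every measurable `A` with `ν A < ∞` the random variable `Ξ(A)` is
Poisson distributed with parameter `ν A`, and the values of `Ξ` on finitely many pairwise disjoint
measurable sets are independent. -/
structure IsPoissonProcess {Ω E : Type*} [MeasurableSpace Ω] [MeasurableSpace E]
    (Ξ : Ω → Measure E) (ν : Measure E) (P : Measure Ω) : Prop where
  measurable : ∀ A : Set E, MeasurableSet A → Measurable (fun ω => Ξ ω A)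
  hasLaw : ∀ A : Set E, MeasurableSet A → ν A ≠ ∞ →
    HasLaw (fun ω => Ξ ω A)
      ((poissonMeasure (ν A).toNNReal).map (Nat.cast : ℕ → ℝ≥0∞)) P
  indep : ∀ (m : ℕ) (A : Fin m → Set E), (∀ i, MeasurableSet (A i)) →
    Pairwise (fun i j => Disjoint (A i) (A j)) →
    iIndepFun (fun (i : Fin m) (ω : Ω) => Ξ ω (A i)) P

/-- The point configuration `∑_{j ∈ ℤ} ε_{ξ_j}`, where `ε_x` is the Dirac measure at `x`. -/
def pointConfiguration {Ω E : Type*} [MeasurableSpace E] (ξ : ℤ → Ω → E) (ω : Ω) : Measure E :=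
  Measure.sum (fun j => Measure.dirac (ξ j ω))

/-- The location `X_t^{(j)} = ξ_j + Y_t^{(j)}` of the `j`-th particle at time `t`. -/
def location {Ω E : Type*} [Add E] (ξ : ℤ → Ω → E) (Y : ℤ → ℝ≥0 → Ω → E)
    (j : ℤ) (t : ℝ≥0) (ω : Ω) : E :=
  ξ j ω + Y j t ω

/-- The Smoluchowski process `N(t) = ∑_{j ∈ ℤ} 1{X_t^{(j)} ∈ B}`, as a sum in `[0, ∞]`. -/
def smoluchowski {Ω E : Type*} [Add E] (ξ : ℤ → Ω → E) (Y : ℤ → ℝ≥0 → Ω → E) (B : Set E)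
    (t : ℝ≥0) (ω : Ω) : ℝ≥0∞ :=
  ∑' j : ℤ, B.indicator (fun _ => (1 : ℝ≥0∞)) (location ξ Y j t ω)

/-- `Q_π(x; t_1, …, t_n)`, the probability that `x + Y_{t_k}` lies in `B` for all `k ∈ π` and
outside `B` for all `k ∉ π`. -/
def Q {Ω E : Type*} [MeasurableSpace Ω] [Add E] (P : Measure Ω) (Y : ℝ≥0 → Ω → E) (B : Set E)
    {n : ℕ} (t : Fin n → ℝ≥0) (π : Finset (Fin n)) (x : E) : ℝ :=
  P.real ({ω | ∀ k ∈ π, x + Y (t k) ω ∈ B} ∩ {ω | ∀ k ∉ π, x + Y (t k) ω ∉ B})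

/-- `Q̄_π(t_1, …, t_n) = ∫ Q_π(x; t_1, …, t_n) dx`, an integral over the whole space. -/
def Qbar {Ω E : Type*} [MeasurableSpace Ω] [Add E] [MeasureSpace E] (P : Measure Ω)
    (Y : ℝ≥0 → Ω → E) (B : Set E) {n : ℕ} (t : Fin n → ℝ≥0) (π : Finset (Fin n)) : ℝ :=
  ∫ x : E, Q P Y B t π x

end

end Smoluchowski

/-!
Attach to the `j`-th particle the mark `(Y^{(j)}_{t_1}, …, Y^{(j)}_{t_n})`. The marks are i.i.d. with
some law `μ` and independent of the Poisson process of starting points, whose intensity is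
`ν = λ dx`. With `g (x, y) = ∑ k, θ k * 1_B (x + y k)` one has
`∑ k, θ k * N (t k) = ∑' j, g (ξ j, mark j)`, so the identity is the exponential formula
`E exp (∑' j, g (ξ j, mark j)) = exp (∫ (exp g - 1) d(ν ⊗ μ))`
(`IsPoissonProcess.integral_exp_tsum_mark`), after `exp g - 1` is expanded over the set `π` of
observations that find a particle in `B` (`exp_sum_visit_sub_one`). Translation invariance of
Lebesgue measure makes the mean number of visits to `B` at a fixed time equal to `λ |B|`, which gives
all finiteness statements.

The exponential formula is proved first without marks (`IsPoissonProcess.integral_exp_tsum`): for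
simple functions it is the independence of Poisson counts on disjoint sets, and bounded integrable
functions are approximated by simple ones. Integrating out the marks of finitely many points
replaces `g` by `φ x = log ∫ exp (g (x, y)) dμ y` (`integral_exp_sum_mark`), which is again bounded
and integrable, and the passage to all points is `tendsto_integral_exp_sum`. Since `g` may take both
signs, monotone convergence is not available; each limit is dominated by the exponential functional
of `|g|`, `|φ|` or `2 * |φ|`, whose integrability comes from Fatou's lemma.
-/

namespace Smoluchowski

open Filter
open scoped Topology

/-! ### Limits of integrals of exponentials -/

/-- Fatou's lemma for real integrals. -/
lemma integrable_of_tendsto_of_integral_le {Ω ι : Type*} [MeasurableSpace Ω] {μ : Measure Ω}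
    {l : Filter ι} [l.NeBot] [l.IsCountablyGenerated] {Z : ι → Ω → ℝ} {Z' : Ω → ℝ} {K : ℝ}
    (hZ : ∀ i, Integrable (Z i) μ) (h0 : ∀ i ω, 0 ≤ Z i ω) (hK : ∀ i, ∫ ω, Z i ω ∂μ ≤ K)
    (hlim : ∀ᵐ ω ∂μ, Tendsto (fun i => Z i ω) l (𝓝 (Z' ω))) :
    Integrable Z' μ ∧ ∫ ω, Z' ω ∂μ ≤ K := by
  have hm : AEStronglyMeasurable Z' μ :=
    aestronglyMeasurable_of_tendsto_ae l (fun i => (hZ i).1) hlim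
  have hZ' : 0 ≤ᵐ[μ] Z' := by
    filter_upwards [hlim] with ω hω
    exact ge_of_tendsto' hω fun i => h0 i ω
  have hle : ∫⁻ ω, ENNReal.ofReal (Z' ω) ∂μ ≤ ENNReal.ofReal K := by
    calc ∫⁻ ω, ENNReal.ofReal (Z' ω) ∂μ
        = ∫⁻ ω, liminf (fun i => ENNReal.ofReal (Z i ω)) l ∂μ := by
          refine lintegral_congr_ae ?_
          filter_upwards [hlim] with ω hω
          exact ((ENNReal.continuous_ofReal.tendsto _).comp hω).liminf_eq.symm
      _ ≤ liminf (fun i => ∫⁻ ω, ENNReal.ofReal (Z i ω) ∂μ) l :=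
          lintegral_liminf_le' fun i => (hZ i).1.aemeasurable.ennreal_ofReal
      _ ≤ ENNReal.ofReal K := by
          refine liminf_le_of_frequently_le' (Frequently.of_forall fun i => ?_)
          rw [← ofReal_integral_eq_lintegral_ofReal (hZ i) (ae_of_all _ (h0 i))]
          exact ENNReal.ofReal_le_ofReal (hK i)
  have hint : Integrable Z' μ :=
    ⟨hm, (hasFiniteIntegral_iff_ofReal hZ').2 (hle.trans_lt ENNReal.ofReal_lt_top)⟩
  have hK0 : 0 ≤ K := by
    obtain ⟨i⟩ := l.nonempty_of_neBot
    exact (integral_nonneg (h0 i)).trans (hK i)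
  refine ⟨hint, ?_⟩
  rw [← ENNReal.ofReal_le_ofReal_iff hK0, ofReal_integral_eq_lintegral_ofReal hint hZ']
  exact hle

/-- If the exponential moments of the absolute partial sums of a series of random variables are
bounded, then the exponential moments of the partial sums converge to that of the series. -/
lemma tendsto_integral_exp_sum {Ω ι : Type*} [Countable ι] [MeasurableSpace Ω] {μ : Measure Ω}
    {X : ι → Ω → ℝ} (hX : ∀ j, Measurable (X j))
    (hsum : ∀ᵐ ω ∂μ, Summable fun j => |X j ω|) {K : ℝ}
    (hint : ∀ J : Finset ι, Integrable (fun ω => Real.exp (∑ j ∈ J, |X j ω|)) μ)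
    (hK : ∀ J : Finset ι, ∫ ω, Real.exp (∑ j ∈ J, |X j ω|) ∂μ ≤ K) :
    Integrable (fun ω => Real.exp (∑' j, X j ω)) μ ∧
      Tendsto (fun J : Finset ι => ∫ ω, Real.exp (∑ j ∈ J, X j ω) ∂μ) atTop
        (𝓝 (∫ ω, Real.exp (∑' j, X j ω) ∂μ)) := by
  have habs : Integrable (fun ω => Real.exp (∑' j, |X j ω|)) μ := by
    refine (integrable_of_tendsto_of_integral_le (l := atTop) hint
      (fun J ω => (Real.exp_pos _).le) hK ?_).1
    filter_upwards [hsum] with ω hω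
    exact (Real.continuous_exp.tendsto _).comp hω.hasSum
  have hmJ : ∀ J : Finset ι, Measurable fun ω => Real.exp (∑ j ∈ J, X j ω) := fun J =>
    Real.measurable_exp.comp (Finset.measurable_fun_sum _ fun j _ => hX j)
  have hlim : ∀ᵐ ω ∂μ, Tendsto (fun J : Finset ι => Real.exp (∑ j ∈ J, X j ω)) atTop
      (𝓝 (Real.exp (∑' j, X j ω))) := by
    filter_upwards [hsum] with ω hω
    exact (Real.continuous_exp.tendsto _).comp (Summable.of_abs hω).hasSum
  have hb : ∀ᵐ ω ∂μ, ∀ J : Finset ι,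
      ‖Real.exp (∑ j ∈ J, X j ω)‖ ≤ Real.exp (∑' j, |X j ω|) := by
    filter_upwards [hsum] with ω hω J
    rw [Real.norm_of_nonneg (Real.exp_pos _).le, Real.exp_le_exp]
    exact (Finset.sum_le_sum fun j _ => le_abs_self _).trans
      (hω.sum_le_tsum J fun j _ => abs_nonneg _)
  refine ⟨habs.mono' (aestronglyMeasurable_of_tendsto_ae atTop
    (fun J => (hmJ J).aestronglyMeasurable) hlim) ?_, ?_⟩
  · filter_upwards [hlim, hb] with ω hω hωb
    exact le_of_tendsto' hω.norm hωb
  · refine tendsto_integral_filter_of_dominated_convergence (fun ω => Real.exp (∑' j, |X j ω|))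
      (Eventually.of_forall fun J => (hmJ J).aestronglyMeasurable)
      (Eventually.of_forall fun J => ?_) habs hlim
    filter_upwards [hb] with ω hω using hω J

lemma abs_exp_sub_one_le_mul_exp_abs (x : ℝ) : |Real.exp x - 1| ≤ |x| * Real.exp |x| := by
  have h1 := Real.add_one_le_exp x
  have h2 : Real.exp x - 1 ≤ x * Real.exp x := by
    have h := mul_le_mul_of_nonneg_left (Real.add_one_le_exp (-x)) (Real.exp_pos x).le
    rw [← Real.exp_add, add_neg_cancel, Real.exp_zero] at h
    linarith
  rcases le_total 0 x with hx | hx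
  · rw [abs_of_nonneg hx, abs_of_nonneg (by linarith)]
    exact h2
  · have h3 : Real.exp x ≤ 1 := Real.exp_le_one_iff.2 hx
    have h4 : 1 ≤ Real.exp (-x) := Real.one_le_exp (by linarith)
    rw [abs_of_nonpos hx, abs_of_nonpos (by linarith)]
    nlinarith

lemma integrable_exp_sub_one {E : Type*} [MeasurableSpace E] {ν : Measure E} {φ : E → ℝ} {C : ℝ}
    (hφ : Integrable φ ν) (hC : ∀ x, |φ x| ≤ C) : Integrable (fun x => Real.exp (φ x) - 1) ν := by
  refine (hφ.abs.mul_const (Real.exp C)).mono'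
    ((Real.continuous_exp.comp_aestronglyMeasurable hφ.1).sub aestronglyMeasurable_const)
    (ae_of_all _ fun x => ?_)
  exact (abs_exp_sub_one_le_mul_exp_abs _).trans
    (mul_le_mul_of_nonneg_left (Real.exp_le_exp.2 (hC x)) (abs_nonneg _))

/-! ### The Poisson distribution -/

lemma hasSum_poisson_exp (r : ℝ≥0) (c : ℝ) :
    HasSum (fun k : ℕ => Real.exp (-r) * (r : ℝ) ^ k / (k.factorial : ℝ) * Real.exp (c * k))
      (Real.exp (r * (Real.exp c - 1))) := by
  have h := (NormedSpace.expSeries_div_hasSum_exp (r * Real.exp c : ℝ)).mul_left (Real.exp (-r))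
  rw [← Real.exp_eq_exp_ℝ, ← Real.exp_add] at h
  convert! h using 1
  · funext k
    rw [mul_pow, ← Real.exp_nat_mul, mul_comm c]
    ring
  · ring_nf

lemma integrable_exp_poisson (r : ℝ≥0) (c : ℝ) :
    Integrable (fun x : ℝ≥0∞ => Real.exp (c * x.toReal))
      ((poissonMeasure r).map (Nat.cast : ℕ → ℝ≥0∞)) := by
  rw [integrable_map_measure (by fun_prop) Measurable.of_discrete.aemeasurable,
    integrable_poissonMeasure_iff]
  simpa using (hasSum_poisson_exp r c).summable

lemma integral_exp_poisson (r : ℝ≥0) (c : ℝ) :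
    ∫ x, Real.exp (c * x.toReal) ∂((poissonMeasure r).map (Nat.cast : ℕ → ℝ≥0∞)) =
      Real.exp (r * (Real.exp c - 1)) := by
  rw [integral_map Measurable.of_discrete.aemeasurable (by fun_prop), integral_poissonMeasure]
  simpa using (hasSum_poisson_exp r c).tsum_eq

lemma lintegral_poisson (r : ℝ≥0) :
    ∫⁻ x, x ∂((poissonMeasure r).map (Nat.cast : ℕ → ℝ≥0∞)) = r := by
  have h : HasSum (fun k : ℕ => Real.exp (-r) * (r : ℝ) ^ k / (k.factorial : ℝ) * k) r := by
    rw [← hasSum_nat_add_iff' 1]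
    convert! (hasSum_one_poissonMeasure r).mul_left (r : ℝ) using 1
    · funext k
      rw [Nat.factorial_succ]
      push_cast
      field_simp
      ring
    · simp
  rw [lintegral_map measurable_id' Measurable.of_discrete, poissonMeasure, lintegral_sum_measure]
  simp only [lintegral_smul_measure, lintegral_dirac, smul_eq_mul]
  have h' : (r : ℝ≥0∞) = ENNReal.ofReal
      (∑' k : ℕ, Real.exp (-r) * (r : ℝ) ^ k / (k.factorial : ℝ) * k) := by
    rw [h.tsum_eq, ENNReal.ofReal_coe_nnreal]
  rw [h', ENNReal.ofReal_tsum_of_nonneg (fun k => by positivity) h.summable]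
  congr 1
  funext k
  rw [ENNReal.ofReal_mul (by positivity), ENNReal.ofReal_natCast]

/-! ### The exponential functional of a Poisson process -/

lemma pointConfiguration_apply {Ω E : Type*} [MeasurableSpace E] {ξ : ℤ → Ω → E} (ω : Ω)
    {A : Set E} (hA : MeasurableSet A) :
    pointConfiguration ξ ω A = ∑' j, A.indicator (fun _ => (1 : ℝ≥0∞)) (ξ j ω) := by
  rw [pointConfiguration, Measure.sum_apply _ hA]
  congr with j
  rw [Measure.dirac_apply' _ hA]
  rfl

section Poisson

variable {Ω E : Type*} [MeasurableSpace Ω] [MeasurableSpace E] {P : Measure Ω} {ν : Measure E}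
  {ξ : ℤ → Ω → E}

/-- Campbell's formula: the laws of the points sum up to the intensity measure. -/
lemma IsPoissonProcess.sum_map_eq [SigmaFinite ν]
    (h : IsPoissonProcess (pointConfiguration ξ) ν P) (hξ : ∀ j, Measurable (ξ j)) :
    Measure.sum (fun j => P.map (ξ j)) = ν := by
  have hfin : ∀ A, MeasurableSet A → ν A ≠ ∞ → Measure.sum (fun j => P.map (ξ j)) A = ν A := by
    intro A hA hνA
    have h1 := h.hasLaw A hA hνA
    calc Measure.sum (fun j => P.map (ξ j)) A
        = ∑' j, ∫⁻ ω, A.indicator (fun _ => (1 : ℝ≥0∞)) (ξ j ω) ∂P := by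
          rw [Measure.sum_apply _ hA]
          congr with j
          rw [← lintegral_map (measurable_const.indicator hA) (hξ j), lintegral_indicator hA,
            setLIntegral_one]
      _ = ∫⁻ ω, pointConfiguration ξ ω A ∂P := by
          simp_rw [pointConfiguration_apply _ hA]
          exact (lintegral_tsum fun j =>
            ((measurable_const.indicator hA).comp (hξ j)).aemeasurable).symm
      _ = ν A := by
          have h2 := lintegral_map' (μ := P) (f := fun x : ℝ≥0∞ => x) aemeasurable_id'
            h1.aemeasurable
          rw [← h2, h1.map_eq, lintegral_poisson, ENNReal.coe_toNNReal hνA]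
  refine (Measure.ext_iff_of_iUnion_eq_univ (iUnion_spanningSets ν)).2 fun i => ?_
  ext A hA
  rw [Measure.restrict_apply hA, Measure.restrict_apply hA]
  exact hfin _ (hA.inter (measurableSet_spanningSets ν i))
    ((measure_mono Set.inter_subset_right).trans_lt (measure_spanningSets_lt_top ν i)).ne

lemma IsPoissonProcess.tsum_lintegral [SigmaFinite ν]
    (h : IsPoissonProcess (pointConfiguration ξ) ν P) (hξ : ∀ j, Measurable (ξ j))
    {f : E → ℝ≥0∞} (hf : Measurable f) :
    ∑' j, ∫⁻ ω, f (ξ j ω) ∂P = ∫⁻ x, f x ∂ν := by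
  rw [← h.sum_map_eq hξ, lintegral_sum_measure]
  congr with j
  rw [lintegral_map hf (hξ j)]

lemma ae_summable_abs_of_tsum_lintegral_ne_top {ι : Type*} [Countable ι] {X : ι → Ω → ℝ}
    (hX : ∀ j, Measurable (X j)) (h : ∑' j, ∫⁻ ω, ENNReal.ofReal |X j ω| ∂P ≠ ∞) :
    ∀ᵐ ω ∂P, Summable fun j => |X j ω| := by
  have hm : ∀ j, Measurable fun ω => ENNReal.ofReal |X j ω| := fun j =>
    ((hX j).abs).ennreal_ofReal
  rw [← lintegral_tsum fun j => (hm j).aemeasurable] at h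
  filter_upwards [ae_lt_top (Measurable.tsum hm) h] with ω hω
  refine (ENNReal.summable_toReal hω.ne).congr fun j => ?_
  exact ENNReal.toReal_ofReal (abs_nonneg _)

lemma IsPoissonProcess.ae_summable_abs [SigmaFinite ν]
    (h : IsPoissonProcess (pointConfiguration ξ) ν P) (hξ : ∀ j, Measurable (ξ j))
    {φ : E → ℝ} (hφm : Measurable φ) (hφ : Integrable φ ν) :
    ∀ᵐ ω ∂P, Summable fun j => |φ (ξ j ω)| := by
  refine ae_summable_abs_of_tsum_lintegral_ne_top (fun j => hφm.comp (hξ j)) ?_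
  rw [h.tsum_lintegral hξ (f := fun x => ENNReal.ofReal |φ x|) hφm.abs.ennreal_ofReal]
  exact (hφ.abs.lintegral_lt_top).ne

/-- The exponential functional on finite linear combinations of indicators of disjoint sets: the
corresponding particle counts are independent and Poisson. -/
lemma IsPoissonProcess.integral_exp_sum_count
    (h : IsPoissonProcess (pointConfiguration ξ) ν P) [IsProbabilityMeasure P]
    {κ : Type*} [Fintype κ] {A : κ → Set E} (c : κ → ℝ) (hA : ∀ i, MeasurableSet (A i))
    (hd : Pairwise fun i j => Disjoint (A i) (A j)) (hν : ∀ i, ν (A i) ≠ ∞) :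
    Integrable (fun ω => Real.exp (∑ i, c i * (pointConfiguration ξ ω (A i)).toReal)) P ∧
      ∫ ω, Real.exp (∑ i, c i * (pointConfiguration ξ ω (A i)).toReal) ∂P =
        Real.exp (∑ i, ν.real (A i) * (Real.exp (c i) - 1)) := by
  have hind : iIndepFun (fun (i : κ) (ω : Ω) => pointConfiguration ξ ω (A i)) P := by
    let e := Fintype.equivFin κ
    have h1 := h.indep (Fintype.card κ) (fun i => A (e.symm i)) (fun i => hA _)
      (fun i j hij => hd (e.symm.injective.ne hij))
    simpa using! h1.precomp e.injective
  have hind' : iIndepFun (fun (i : κ) (ω : Ω) =>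
      c i * (pointConfiguration ξ ω (A i)).toReal) P :=
    hind.comp (fun i x => c i * x.toReal) (fun i => by fun_prop)
  have hm : ∀ i, Measurable fun ω => c i * (pointConfiguration ξ ω (A i)).toReal := fun i => by
    have := h.measurable _ (hA i)
    fun_prop
  have hi : ∀ i, Integrable (fun ω =>
      Real.exp (1 * (c i * (pointConfiguration ξ ω (A i)).toReal))) P := fun i => by
    have h1 := h.hasLaw _ (hA i) (hν i)
    have h2 := integrable_exp_poisson (ν (A i)).toNNReal (c i)
    rw [← h1.map_eq] at h2
    simpa using! h2.comp_aemeasurable h1.aemeasurable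
  constructor
  · simpa using hind'.integrable_exp_mul_sum hm (s := Finset.univ) (t := 1) fun i _ => hi i
  · have hmgf := hind'.mgf_sum (t := 1) hm Finset.univ
    simp only [mgf, one_mul, Finset.sum_apply] at hmgf
    rw [hmgf, Real.exp_sum]
    refine Finset.prod_congr rfl fun i _ => ?_
    have h1 := h.hasLaw _ (hA i) (hν i)
    have h2 := integral_map (μ := P) (f := fun x : ℝ≥0∞ => Real.exp (c i * x.toReal))
      h1.aemeasurable (by fun_prop)
    rw [← h2, h1.map_eq, integral_exp_poisson]
    rfl

lemma IsPoissonProcess.integral_exp_tsum_simpleFunc [SigmaFinite ν] [IsProbabilityMeasure P]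
    (h : IsPoissonProcess (pointConfiguration ξ) ν P)
    (s : SimpleFunc E ℝ) (hs : Integrable s ν) :
    Integrable (fun ω => Real.exp (∑' j, s (ξ j ω))) P ∧
      ∫ ω, Real.exp (∑' j, s (ξ j ω)) ∂P = Real.exp (∫ x, (Real.exp (s x) - 1) ∂ν) := by
  classical
  let R : Finset ℝ := s.range.filter (· ≠ 0)
  let A : R → Set E := fun c => s ⁻¹' {(c : ℝ)}
  have hA : ∀ c, MeasurableSet (A c) := fun c => s.measurableSet_fiber _
  have hR : ∀ c : R, (c : ℝ) ≠ 0 := fun c => (Finset.mem_filter.1 c.2).2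
  have hν : ∀ c, ν (A c) ≠ ∞ := fun c => (SimpleFunc.integrable_iff.1 hs _ (hR c)).ne
  have hd : Pairwise fun c c' => Disjoint (A c) (A c') := fun c c' hcc' =>
    Disjoint.preimage s (by simpa using fun h' => hcc' (Subtype.ext h'))
  -- any function of `s` vanishing at `0` is a combination of the indicators of the fibres
  have hdec : ∀ (u : ℝ → ℝ), u 0 = 0 → ∀ x,
      u (s x) = ∑ c : R, u c * (A c).indicator (fun _ => (1 : ℝ)) x := by
    intro u hu x
    by_cases hx : s x = 0
    · rw [hx, hu, Finset.sum_eq_zero]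
      intro c _
      rw [Set.indicator_of_notMem, mul_zero]
      exact fun hc => hR c (by simpa [A, hx] using hc.symm)
    · have hmem : s x ∈ R := Finset.mem_filter.2 ⟨s.mem_range_self x, hx⟩
      rw [Finset.sum_eq_single ⟨s x, hmem⟩]
      · simp [A]
      · intro c _ hc
        rw [Set.indicator_of_notMem, mul_zero]
        exact fun hc' => hc (Subtype.ext (by simpa [A] using hc'.symm))
      · simp
  have hfinA : ∀ᵐ ω ∂P, ∀ c, pointConfiguration ξ ω (A c) ≠ ∞ := by
    rw [ae_all_iff]
    intro c
    have h1 := h.hasLaw _ (hA c) (hν c)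
    have h2 : ∫⁻ ω, pointConfiguration ξ ω (A c) ∂P ≠ ∞ := by
      rw [← lintegral_map' (f := fun x : ℝ≥0∞ => x) aemeasurable_id' h1.aemeasurable, h1.map_eq,
        lintegral_poisson]
      exact ENNReal.coe_ne_top
    filter_upwards [ae_lt_top (h.measurable _ (hA c)) h2] with ω hω using hω.ne
  have hsum : ∀ᵐ ω ∂P,
      ∑' j, s (ξ j ω) = ∑ c : R, (c : ℝ) * (pointConfiguration ξ ω (A c)).toReal := by
    filter_upwards [hfinA] with ω hω
    have h1 : ∀ c : R, HasSum (fun j => (A c).indicator (fun _ => (1 : ℝ)) (ξ j ω))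
        (pointConfiguration ξ ω (A c)).toReal := fun c => by
      have h2 := hω c
      rw [pointConfiguration_apply _ (hA c)] at h2 ⊢
      have h3 := ENNReal.hasSum_toReal h2
      rw [← ENNReal.tsum_toReal_eq (ENNReal.ne_top_of_tsum_ne_top h2)] at h3
      refine h3.congr_fun fun j => ?_
      by_cases hj : ξ j ω ∈ A c <;> simp [hj]
    have h3 := hasSum_sum fun (c : R) (_ : c ∈ Finset.univ) => (h1 c).mul_left (c : ℝ)
    simp_rw [← hdec (fun y => y) rfl] at h3
    exact h3.tsum_eq
  have hcount := h.integral_exp_sum_count (fun c : R => (c : ℝ)) hA hd hν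
  have hae : (fun ω => Real.exp (∑' j, s (ξ j ω))) =ᵐ[P] fun ω =>
      Real.exp (∑ c : R, (c : ℝ) * (pointConfiguration ξ ω (A c)).toReal) := by
    filter_upwards [hsum] with ω hω
    rw [hω]
  refine ⟨hcount.1.congr hae.symm, ?_⟩
  rw [integral_congr_ae hae, hcount.2]
  congr 1
  simp_rw [hdec (fun y => Real.exp y - 1) (by simp)]
  rw [integral_finsetSum]
  · refine Finset.sum_congr rfl fun c _ => ?_
    rw [integral_const_mul, integral_indicator (hA c)]
    simp [mul_comm]
  · intro c _
    exact ((integrable_indicator_iff (hA c)).2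
      (integrableOn_const (hν c))).const_mul _

/-- The exponential functional of a Poisson process, for bounded integrable functions. -/
theorem IsPoissonProcess.integral_exp_tsum [SigmaFinite ν] [IsProbabilityMeasure P]
    (h : IsPoissonProcess (pointConfiguration ξ) ν P) (hξ : ∀ j, Measurable (ξ j))
    {φ : E → ℝ} (hφm : Measurable φ) (hφ : Integrable φ ν) {C : ℝ} (hC : ∀ x, |φ x| ≤ C) :
    Integrable (fun ω => Real.exp (∑' j, φ (ξ j ω))) P ∧
      ∫ ω, Real.exp (∑' j, φ (ξ j ω)) ∂P = Real.exp (∫ x, (Real.exp (φ x) - 1) ∂ν) := by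
  -- simple functions dominated by `2 |ψ|` and converging to `ψ`
  let S : ∀ ψ : E → ℝ, Measurable ψ → ℕ → SimpleFunc E ℝ := fun ψ hψ =>
    SimpleFunc.approxOn ψ hψ Set.univ 0 (Set.mem_univ 0)
  have hSle : ∀ ψ hψ n x, |S ψ hψ n x| ≤ 2 * |ψ x| := fun ψ hψ n x => by
    have := SimpleFunc.norm_approxOn_zero_le hψ (Set.mem_univ 0) x n
    rw [two_mul]
    exact this
  have hSlim : ∀ ψ hψ x, Tendsto (fun n => S ψ hψ n x) atTop (𝓝 (ψ x)) := fun ψ hψ x =>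
    SimpleFunc.tendsto_approxOn hψ (Set.mem_univ 0) (by simp)
  have hSint : ∀ ψ hψ n, Integrable ψ ν → Integrable (S ψ hψ n) ν := fun ψ hψ n hi =>
    SimpleFunc.integrable_approxOn hψ hi _ (integrable_zero _ _ _) n
  have htsum : ∀ ψ hψ, Integrable ψ ν → ∀ᵐ ω ∂P,
      Tendsto (fun n => Real.exp (∑' j, S ψ hψ n (ξ j ω))) atTop
        (𝓝 (Real.exp (∑' j, ψ (ξ j ω)))) := fun ψ hψ hi => by
    filter_upwards [h.ae_summable_abs hξ hψ hi] with ω hω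
    exact (Real.continuous_exp.tendsto _).comp <|
      tendsto_tsum_of_dominated_convergence (hω.mul_left 2) (fun j => hSlim ψ hψ _)
        (Eventually.of_forall fun n j => hSle ψ hψ n _)
  -- exponential integrability, by Fatou's lemma and `S ψ hψ n ≤ 2 |ψ|`
  have hexpint : ∀ (ψ : E → ℝ) (hψ : Measurable ψ), Integrable ψ ν → (∃ D, ∀ x, |ψ x| ≤ D) →
      Integrable (fun ω => Real.exp (∑' j, ψ (ξ j ω))) P := by
    rintro ψ hψ hi ⟨D, hD⟩
    refine (integrable_of_tendsto_of_integral_le (l := atTop)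
      (K := Real.exp (∫ x, (Real.exp (2 * |ψ x|) - 1) ∂ν))
      (fun n => (h.integral_exp_tsum_simpleFunc _ (hSint ψ hψ n hi)).1)
      (fun n ω => (Real.exp_pos _).le) (fun n => ?_) (htsum ψ hψ hi)).1
    rw [(h.integral_exp_tsum_simpleFunc _ (hSint ψ hψ n hi)).2, Real.exp_le_exp]
    refine integral_mono (integrable_exp_sub_one (C := 2 * D) (hSint ψ hψ n hi) fun x => ?_)
      (integrable_exp_sub_one (C := 2 * D) (hi.abs.const_mul 2) fun x => ?_) fun x => ?_
    · exact (hSle ψ hψ n x).trans (by linarith [hD x])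
    · rw [abs_of_nonneg (by positivity)]
      linarith [hD x]
    · have := (le_abs_self _).trans (hSle ψ hψ n x)
      simpa using this
  have hdom : Integrable (fun ω => Real.exp (∑' j, 2 * |φ (ξ j ω)|)) P :=
    hexpint (fun x => 2 * |φ x|) (by fun_prop) (hφ.abs.const_mul 2) ⟨2 * C, fun x => by
      rw [abs_of_nonneg (by positivity)]
      linarith [hC x]⟩
  refine ⟨hexpint φ hφm hφ ⟨C, hC⟩, ?_⟩
  have hl : Tendsto (fun n => ∫ ω, Real.exp (∑' j, S φ hφm n (ξ j ω)) ∂P) atTop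
      (𝓝 (∫ ω, Real.exp (∑' j, φ (ξ j ω)) ∂P)) := by
    refine tendsto_integral_of_dominated_convergence _
      (fun n => (h.integral_exp_tsum_simpleFunc _ (hSint φ hφm n hφ)).1.1) hdom
      (fun n => ?_) (htsum φ hφm hφ)
    filter_upwards [h.ae_summable_abs hξ hφm hφ] with ω hω
    rw [Real.norm_of_nonneg (Real.exp_pos _).le, Real.exp_le_exp]
    have h2 := hω.mul_left 2
    exact (Summable.of_norm_bounded h2 fun j => hSle φ hφm n _).tsum_le_tsum
      (fun j => (le_abs_self _).trans (hSle φ hφm n _)) h2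
  have hr : Tendsto (fun n => ∫ x, (Real.exp (S φ hφm n x) - 1) ∂ν) atTop
      (𝓝 (∫ x, (Real.exp (φ x) - 1) ∂ν)) := by
    refine tendsto_integral_of_dominated_convergence
      (fun x => (2 * |φ x|) * Real.exp (2 * C))
      (fun n => (integrable_exp_sub_one (C := 2 * C) (hSint φ hφm n hφ) fun x => ?_).1)
      ((hφ.abs.const_mul 2).mul_const _) (fun n => ae_of_all _ fun x => ?_)
      (ae_of_all _ fun x => ((Real.continuous_exp.tendsto _).comp (hSlim φ hφm x)).sub_const 1)
    · exact (hSle φ hφm n x).trans (by linarith [hC x])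
    · have h1 := hSle φ hφm n x
      refine (abs_exp_sub_one_le_mul_exp_abs _).trans ?_
      gcongr
      linarith [hC x]
  refine tendsto_nhds_unique hl ?_
  simp_rw [fun n => (h.integral_exp_tsum_simpleFunc _ (hSint φ hφm n hφ)).2]
  exact (Real.continuous_exp.tendsto _).comp hr

end Poisson

/-! ### Independent marking -/

section Marking

variable {Ω E M : Type*} [MeasurableSpace Ω] [MeasurableSpace E] [MeasurableSpace M]
  {P : Measure Ω} {ν : Measure E} {μ : Measure M} {ξ : ℤ → Ω → E} {W : ℤ → Ω → M}
  {g : E × M → ℝ} {C : ℝ}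

/-- The logarithm of the conditional exponential moment of a point at `x` carrying a random mark
with law `μ`. -/
noncomputable def logMarkMoment (μ : Measure M) (g : E × M → ℝ) (x : E) : ℝ :=
  Real.log (∫ y, Real.exp (g (x, y)) ∂μ)

lemma integrable_exp_mark [IsFiniteMeasure μ] (hgm : Measurable g) (hC : ∀ z, |g z| ≤ C) (x : E) :
    Integrable (fun y => Real.exp (g (x, y))) μ := by
  refine Integrable.of_bound (C := Real.exp C)
    (Measurable.aestronglyMeasurable (by fun_prop)) (ae_of_all _ fun y => ?_)
  rw [Real.norm_of_nonneg (Real.exp_pos _).le, Real.exp_le_exp]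
  exact (le_abs_self _).trans (hC _)

lemma exp_neg_le_integral_exp_mark [IsProbabilityMeasure μ] (hgm : Measurable g)
    (hC : ∀ z, |g z| ≤ C) (x : E) : Real.exp (-C) ≤ ∫ y, Real.exp (g (x, y)) ∂μ := by
  have h := integral_mono (integrable_const (μ := μ) (Real.exp (-C)))
    (integrable_exp_mark hgm hC x) fun y => Real.exp_le_exp.2 (abs_le.1 (hC (x, y))).1
  simpa using h

lemma integral_exp_mark_le_exp [IsProbabilityMeasure μ] (hgm : Measurable g)
    (hC : ∀ z, |g z| ≤ C) (x : E) : ∫ y, Real.exp (g (x, y)) ∂μ ≤ Real.exp C := by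
  have h := integral_mono (integrable_exp_mark hgm hC x)
    (integrable_const (μ := μ) (Real.exp C)) fun y => Real.exp_le_exp.2 (abs_le.1 (hC (x, y))).2
  simpa using h

lemma exp_logMarkMoment [IsProbabilityMeasure μ] (hgm : Measurable g) (hC : ∀ z, |g z| ≤ C)
    (x : E) : Real.exp (logMarkMoment μ g x) = ∫ y, Real.exp (g (x, y)) ∂μ :=
  Real.exp_log ((Real.exp_pos _).trans_le (exp_neg_le_integral_exp_mark hgm hC x))

lemma measurable_logMarkMoment [SFinite μ] (hgm : Measurable g) :
    Measurable (logMarkMoment μ g) := by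
  have h : StronglyMeasurable fun z : E × M => Real.exp (g z) :=
    (Real.measurable_exp.comp hgm).stronglyMeasurable
  exact Real.measurable_log.comp h.integral_prod_right'.measurable

lemma abs_logMarkMoment_le [IsProbabilityMeasure μ] (hgm : Measurable g) (hC : ∀ z, |g z| ≤ C)
    (x : E) : |logMarkMoment μ g x| ≤ C := by
  rw [abs_le, ← Real.exp_le_exp, ← Real.exp_le_exp (x := logMarkMoment μ g x),
    exp_logMarkMoment hgm hC]
  exact ⟨exp_neg_le_integral_exp_mark hgm hC x, integral_exp_mark_le_exp hgm hC x⟩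

lemma integrable_logMarkMoment [IsProbabilityMeasure μ] (hgm : Measurable g)
    (hC : ∀ z, |g z| ≤ C) (hg : Integrable g (ν.prod μ)) [SFinite ν] :
    Integrable (logMarkMoment μ g) ν := by
  refine ((hg.abs.integral_prod_left.mul_const (Real.exp C)).mul_const (Real.exp C)).mono'
    (measurable_logMarkMoment hgm).aestronglyMeasurable (ae_of_all _ fun x => ?_)
  have hgx : Integrable (fun y => g (x, y)) μ :=
    Integrable.of_bound (C := C) (Measurable.aestronglyMeasurable (by fun_prop))
      (ae_of_all _ fun y => hC _)
  set m := ∫ y, Real.exp (g (x, y)) ∂μ with hm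
  have h1 : |m - 1| ≤ (∫ y, |g (x, y)| ∂μ) * Real.exp C := by
    have h2 : m - 1 = ∫ y, (Real.exp (g (x, y)) - 1) ∂μ := by
      rw [integral_sub (integrable_exp_mark hgm hC x) (integrable_const _)]
      simp [hm]
    rw [h2, ← integral_mul_const]
    refine abs_integral_le_integral_abs.trans (integral_mono
      (integrable_exp_sub_one hgx fun y => hC _).abs (hgx.abs.mul_const _) fun y => ?_)
    exact (abs_exp_sub_one_le_mul_exp_abs _).trans
      (mul_le_mul_of_nonneg_left (Real.exp_le_exp.2 (hC _)) (abs_nonneg _))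
  have hm0 : Real.exp (-C) ≤ m := exp_neg_le_integral_exp_mark hgm hC x
  have hmpos : 0 < m := (Real.exp_pos _).trans_le hm0
  have hC0 : 0 ≤ C := (abs_nonneg _).trans (abs_logMarkMoment_le (μ := μ) hgm hC x)
  have hinv : m⁻¹ ≤ Real.exp C := by
    rw [← inv_inv (Real.exp C), ← Real.exp_neg]
    exact inv_anti₀ (Real.exp_pos _) hm0
  -- `1 - 1 / m ≤ log m ≤ m - 1`, and `m` is bounded away from zero
  have h3 : |Real.log m| ≤ |m - 1| * Real.exp C := by
    have hup := Real.log_le_sub_one_of_pos hmpos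
    have hlow := Real.one_sub_inv_le_log_of_pos hmpos
    have h4 : 1 - m⁻¹ = (m - 1) * m⁻¹ := by field_simp
    have h5 : |m - 1| ≤ |m - 1| * Real.exp C :=
      le_mul_of_one_le_right (abs_nonneg _) (Real.one_le_exp hC0)
    have h6 : |m - 1| * m⁻¹ ≤ |m - 1| * Real.exp C :=
      mul_le_mul_of_nonneg_left hinv (abs_nonneg _)
    have h7 : -(|m - 1| * m⁻¹) ≤ (m - 1) * m⁻¹ := by
      rw [← neg_mul]
      exact mul_le_mul_of_nonneg_right (neg_abs_le _) (inv_pos.2 hmpos).le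
    rw [abs_le]
    exact ⟨by linarith, by linarith [le_abs_self (m - 1)]⟩
  exact h3.trans (mul_le_mul_of_nonneg_right h1 (Real.exp_pos _).le)

lemma measurable_mark (hξ : ∀ j, Measurable (ξ j)) (hW : ∀ j, Measurable (W j))
    (hgm : Measurable g) (j : ℤ) : Measurable fun ω => g (ξ j ω, W j ω) :=
  hgm.comp ((hξ j).prodMk (hW j))

/-- Integrating out the independent marks of finitely many points replaces the exponential of `g`
at each point by its conditional expectation. -/
lemma integral_exp_sum_mark [IsProbabilityMeasure P] [IsProbabilityMeasure μ]
    (hξ : ∀ j, Measurable (ξ j)) (hW : ∀ j, Measurable (W j)) (hWlaw : ∀ j, P.map (W j) = μ)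
    (hWind : iIndepFun W P) (hξW : IndepFun (fun ω j => ξ j ω) (fun ω j => W j ω) P)
    (hgm : Measurable g) (hC : ∀ z, |g z| ≤ C) (J : Finset ℤ) :
    Integrable (fun ω => Real.exp (∑ j ∈ J, g (ξ j ω, W j ω))) P ∧
      ∫ ω, Real.exp (∑ j ∈ J, g (ξ j ω, W j ω)) ∂P =
        ∫ ω, Real.exp (∑ j ∈ J, logMarkMoment μ g (ξ j ω)) ∂P := by
  have hξ' : Measurable fun ω j => ξ j ω := measurable_pi_lambda _ hξ
  have hW' : Measurable fun ω j => W j ω := measurable_pi_lambda _ hW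
  let H : (ℤ → E) × (ℤ → M) → ℝ := fun z => Real.exp (∑ j ∈ J, g (z.1 j, z.2 j))
  have hH : Measurable H := by fun_prop
  have hHb : ∀ z, ‖H z‖ ≤ Real.exp (J.card • C) := fun z => by
    rw [Real.norm_of_nonneg (Real.exp_pos _).le, Real.exp_le_exp]
    exact Finset.sum_le_card_nsmul _ _ _ fun j _ => (le_abs_self _).trans (hC _)
  refine ⟨Integrable.of_bound (C := Real.exp (J.card • C))
    (hH.comp (hξ'.prodMk hW')).aestronglyMeasurable (ae_of_all _ fun ω =>
    hHb (fun j => ξ j ω, fun j => W j ω)), ?_⟩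
  have : IsProbabilityMeasure (P.map fun ω j => ξ j ω) :=
    Measure.isProbabilityMeasure_map hξ'.aemeasurable
  have : IsProbabilityMeasure (P.map fun ω j => W j ω) :=
    Measure.isProbabilityMeasure_map hW'.aemeasurable
  have hinner : ∀ x : ℤ → E, ∫ w, H (x, w) ∂(P.map fun ω j => W j ω) =
      Real.exp (∑ j ∈ J, logMarkMoment μ g (x j)) := fun x => by
    rw [integral_map hW'.aemeasurable (Measurable.aestronglyMeasurable (by fun_prop))]
    have hJ : iIndepFun (fun j : J => W j) P := hWind.precomp Subtype.val_injective
    have h1 := iIndepFun.integral_fun_prod_comp (𝕜 := ℝ) (X := fun j : J => W j)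
      (f := fun j y => Real.exp (g (x j, y))) hJ (fun j => (hW j).aemeasurable)
      (fun j => Measurable.aestronglyMeasurable (by fun_prop))
    have h2 : ∀ j : J, ∫ ω, Real.exp (g (x j, W j ω)) ∂P = Real.exp (logMarkMoment μ g (x j)) :=
      fun j => by
        rw [exp_logMarkMoment hgm hC, ← hWlaw j,
          integral_map (hW j).aemeasurable (Measurable.aestronglyMeasurable (by fun_prop))]
    simp_rw [h2] at h1
    rw [Finset.prod_coe_sort J fun j => Real.exp (logMarkMoment μ g (x j)), ← Real.exp_sum] at h1
    rw [← h1]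
    congr with ω
    rw [Finset.prod_coe_sort J fun j => Real.exp (g (x j, W j ω)), ← Real.exp_sum]
  have hφ := measurable_logMarkMoment (μ := μ) hgm
  calc ∫ ω, Real.exp (∑ j ∈ J, g (ξ j ω, W j ω)) ∂P
      = ∫ z, H z ∂(P.map fun ω => (fun j => ξ j ω, fun j => W j ω)) :=
        (integral_map (hξ'.prodMk hW').aemeasurable hH.aestronglyMeasurable).symm
    _ = ∫ x, ∫ w, H (x, w) ∂(P.map fun ω j => W j ω) ∂(P.map fun ω j => ξ j ω) := by
        rw [(indepFun_iff_map_prod_eq_prod_map_map hξ'.aemeasurable hW'.aemeasurable).1 hξW]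
        exact integral_prod _
          (Integrable.of_bound hH.aestronglyMeasurable _ (ae_of_all _ hHb))
    _ = ∫ ω, Real.exp (∑ j ∈ J, logMarkMoment μ g (ξ j ω)) ∂P := by
        simp_rw [hinner]
        exact integral_map hξ'.aemeasurable (Measurable.aestronglyMeasurable (by fun_prop))

lemma IsPoissonProcess.ae_summable_abs_mark [SigmaFinite ν] [IsProbabilityMeasure P]
    [IsProbabilityMeasure μ]
    (h : IsPoissonProcess (pointConfiguration ξ) ν P)
    (hξ : ∀ j, Measurable (ξ j)) (hW : ∀ j, Measurable (W j)) (hWlaw : ∀ j, P.map (W j) = μ)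
    (hξW : IndepFun (fun ω j => ξ j ω) (fun ω j => W j ω) P)
    (hgm : Measurable g) (hg : Integrable g (ν.prod μ)) :
    ∀ᵐ ω ∂P, Summable fun j => |g (ξ j ω, W j ω)| := by
  have hm : Measurable fun z => ENNReal.ofReal |g z| := by fun_prop
  refine ae_summable_abs_of_tsum_lintegral_ne_top (measurable_mark hξ hW hgm) ?_
  have hj : ∀ j, ∫⁻ ω, ENNReal.ofReal |g (ξ j ω, W j ω)| ∂P =
      ∫⁻ ω, ∫⁻ y, ENNReal.ofReal |g (ξ j ω, y)| ∂μ ∂P := fun j => by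
    have hind : IndepFun (ξ j) (W j) P :=
      hξW.comp (measurable_pi_apply j) (measurable_pi_apply j)
    have hlaw := (indepFun_iff_map_prod_eq_prod_map_map (hξ j).aemeasurable
      (hW j).aemeasurable).1 hind
    rw [hWlaw] at hlaw
    calc ∫⁻ ω, ENNReal.ofReal |g (ξ j ω, W j ω)| ∂P
        = ∫⁻ z, ENNReal.ofReal |g z| ∂(P.map fun ω => (ξ j ω, W j ω)) :=
          (lintegral_map hm ((hξ j).prodMk (hW j))).symm
      _ = ∫⁻ x, ∫⁻ y, ENNReal.ofReal |g (x, y)| ∂μ ∂(P.map (ξ j)) := by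
          rw [hlaw, lintegral_prod _ hm.aemeasurable]
      _ = _ := lintegral_map hm.lintegral_prod_right' (hξ j)
  simp_rw [hj]
  rw [h.tsum_lintegral hξ (f := fun x => ∫⁻ y, ENNReal.ofReal |g (x, y)| ∂μ)
    hm.lintegral_prod_right', ← lintegral_prod _ hm.aemeasurable]
  exact hg.abs.lintegral_lt_top.ne

lemma IsPoissonProcess.integral_exp_sum_le [SigmaFinite ν] [IsProbabilityMeasure P]
    (h : IsPoissonProcess (pointConfiguration ξ) ν P) (hξ : ∀ j, Measurable (ξ j))
    {φ : E → ℝ} (hφm : Measurable φ) (hφ : Integrable φ ν) (hC : ∀ x, |φ x| ≤ C)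
    (J : Finset ℤ) :
    ∫ ω, Real.exp (∑ j ∈ J, φ (ξ j ω)) ∂P ≤ ∫ ω, Real.exp (∑' j, |φ (ξ j ω)|) ∂P := by
  refine integral_mono_of_nonneg (ae_of_all _ fun ω => (Real.exp_pos _).le)
    (h.integral_exp_tsum hξ hφm.abs hφ.abs (C := C) fun x => by rw [abs_abs]; exact hC x).1 ?_
  filter_upwards [h.ae_summable_abs hξ hφm hφ] with ω hω
  exact Real.exp_le_exp.2 ((Finset.sum_le_sum fun j _ => le_abs_self _).trans
    (hω.sum_le_tsum J fun j _ => abs_nonneg _))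

/-- The exponential functional of an independently marked Poisson process: the points together
with their marks behave as a Poisson process with intensity `ν.prod μ`. -/
theorem IsPoissonProcess.integral_exp_tsum_mark [SigmaFinite ν] [IsProbabilityMeasure P]
    [IsProbabilityMeasure μ]
    (h : IsPoissonProcess (pointConfiguration ξ) ν P)
    (hξ : ∀ j, Measurable (ξ j)) (hW : ∀ j, Measurable (W j)) (hWlaw : ∀ j, P.map (W j) = μ)
    (hWind : iIndepFun W P) (hξW : IndepFun (fun ω j => ξ j ω) (fun ω j => W j ω) P)
    (hgm : Measurable g) (hg : Integrable g (ν.prod μ)) (hC : ∀ z, |g z| ≤ C) :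
    Integrable (fun ω => Real.exp (∑' j, g (ξ j ω, W j ω))) P ∧
      ∫ ω, Real.exp (∑' j, g (ξ j ω, W j ω)) ∂P =
        Real.exp (∫ z, (Real.exp (g z) - 1) ∂(ν.prod μ)) := by
  have hCabs : ∀ z, |(fun z => |g z|) z| ≤ C := fun z => by rw [abs_abs]; exact hC z
  have hφm := measurable_logMarkMoment (μ := μ) hgm
  have hφ := integrable_logMarkMoment hgm hC hg
  have hφC := abs_logMarkMoment_le (μ := μ) hgm hC
  have hmark := integral_exp_sum_mark hξ hW hWlaw hWind hξW hgm hC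
  have hmarkabs := integral_exp_sum_mark hξ hW hWlaw hWind hξW hgm.abs hCabs
  have h1 := tendsto_integral_exp_sum (measurable_mark hξ hW hgm)
    (h.ae_summable_abs_mark hξ hW hWlaw hξW hgm hg) (fun J => (hmarkabs J).1)
    (fun J => (hmarkabs J).2.trans_le <| h.integral_exp_sum_le hξ
      (measurable_logMarkMoment hgm.abs) (integrable_logMarkMoment hgm.abs hCabs hg.abs)
      (abs_logMarkMoment_le hgm.abs hCabs) J)
  have hφJ : ∀ J : Finset ℤ,
      Integrable (fun ω => Real.exp (∑ j ∈ J, |logMarkMoment μ g (ξ j ω)|)) P := fun J =>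
    Integrable.of_bound (C := Real.exp (J.card • C))
      (Measurable.aestronglyMeasurable (by fun_prop)) (ae_of_all _ fun ω => by
      rw [Real.norm_of_nonneg (Real.exp_pos _).le, Real.exp_le_exp]
      exact Finset.sum_le_card_nsmul _ _ _ fun j _ => hφC _)
  have h2 := tendsto_integral_exp_sum (fun j => hφm.comp (hξ j)) (h.ae_summable_abs hξ hφm hφ) hφJ
    (fun J => h.integral_exp_sum_le hξ hφm.abs hφ.abs (C := C)
      (fun x => by rw [abs_abs]; exact hφC x) J)
  refine ⟨h1.1, ?_⟩
  have h3 := h1.2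
  simp_rw [fun J => (hmark J).2] at h3
  rw [tendsto_nhds_unique h3 h2.2]
  refine (h.integral_exp_tsum hξ hφm hφ hφC).2.trans ?_
  rw [integral_prod _ (integrable_exp_sub_one hg hC)]
  congr 2 with x
  rw [exp_logMarkMoment hgm hC, integral_sub (integrable_exp_mark hgm hC x) (integrable_const _)]
  simp

end Marking

/-! ### Occupation patterns of displaced particles -/

section Pattern

variable {E : Type*} [AddCommGroup E] {B : Set E} {n : ℕ}

/-- The indicator that a particle started at `z.1` with displacements `z.2` is in `B` at the `k`-th
observation. -/
noncomputable def visit (B : Set E) (k : Fin n) (z : E × (Fin n → E)) : ℝ :=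
  B.indicator (fun _ => 1) (z.1 + z.2 k)

/-- The pairs of a starting point and displacements for which `π` is exactly the set of
observations that find the particle in `B`. -/
def patternSet (B : Set E) (π : Finset (Fin n)) : Set (E × (Fin n → E)) :=
  {z | (∀ k ∈ π, z.1 + z.2 k ∈ B) ∧ ∀ k ∉ π, z.1 + z.2 k ∉ B}

/-- Exactly one pattern occurs, and the empty one contributes nothing. -/
lemma exp_sum_visit_sub_one (θ : Fin n → ℝ) (z : E × (Fin n → E)) :
    Real.exp (∑ k, θ k * visit B k z) - 1 = ∑ π : Finset (Fin n) with π.Nonempty,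
      (Real.exp (∑ k ∈ π, θ k) - 1) * (patternSet B π).indicator (fun _ => 1) z := by
  classical
  let π₀ : Finset (Fin n) := {k | z.1 + z.2 k ∈ B}
  have hmem : ∀ π, z ∈ patternSet B π ↔ π = π₀ := fun π => by
    constructor
    · rintro ⟨h1, h2⟩
      ext k
      by_cases hk : k ∈ π
      · simp [π₀, hk, h1 k hk]
      · simp [π₀, hk, h2 k hk]
    · rintro rfl
      simp [patternSet, π₀]
  have hsum : ∑ k, θ k * visit B k z = ∑ k ∈ π₀, θ k := by
    rw [Finset.sum_filter]
    refine Finset.sum_congr rfl fun k _ => ?_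
    by_cases hk : z.1 + z.2 k ∈ B <;> simp [visit, hk]
  rw [hsum, Finset.sum_filter_of_ne (p := Finset.Nonempty), Finset.sum_eq_single π₀]
  · rw [Set.indicator_of_mem ((hmem π₀).2 rfl), mul_one]
  · intro π _ hπ
    rw [Set.indicator_of_notMem fun h => hπ ((hmem π).1 h), mul_zero]
  · simp
  · -- the empty pattern contributes `exp 0 - 1 = 0`
    intro π _ hπ
    rw [Finset.nonempty_iff_ne_empty]
    rintro rfl
    simp at hπ

variable [MeasurableSpace E] [MeasurableAdd₂ E]

lemma measurable_add_displacement (k : Fin n) :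
    Measurable fun z : E × (Fin n → E) => z.1 + z.2 k := by
  fun_prop

lemma measurable_visit (hB : MeasurableSet B) (k : Fin n) : Measurable (visit B k) :=
  (measurable_const.indicator hB).comp (measurable_add_displacement k)

lemma measurableSet_patternSet (hB : MeasurableSet B) (π : Finset (Fin n)) :
    MeasurableSet (patternSet B π) := by
  have h : ∀ k : Fin n, MeasurableSet {z : E × (Fin n → E) | z.1 + z.2 k ∈ B} := fun k =>
    measurable_add_displacement k hB
  have h2 : patternSet B π = (⋂ k ∈ π, {z : E × (Fin n → E) | z.1 + z.2 k ∈ B}) ∩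
      ⋂ k ∈ {k | k ∉ π}, {z : E × (Fin n → E) | z.1 + z.2 k ∈ B}ᶜ := by
    ext z
    simp [patternSet]
  rw [h2]
  exact (Finset.measurableSet_biInter _ fun k _ => h k).inter
    (MeasurableSet.biInter (Set.to_countable _) fun k _ => (h k).compl)

variable {ν : Measure E} [ν.IsAddRightInvariant] [SigmaFinite ν] {μ : Measure (Fin n → E)}
  [IsProbabilityMeasure μ]

/-- By translation invariance, the displacement does not matter for the mean number of visits. -/
lemma prod_apply_visit (hB : MeasurableSet B) (k : Fin n) :
    (ν.prod μ) {z | z.1 + z.2 k ∈ B} = ν B := by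
  have hm : MeasurableSet {z : E × (Fin n → E) | z.1 + z.2 k ∈ B} :=
    measurable_add_displacement k hB
  rw [Measure.prod_apply_symm hm]
  have h : ∀ y : Fin n → E, ν ((fun x => (x, y)) ⁻¹' {z | z.1 + z.2 k ∈ B}) = ν B := fun y =>
    measure_preimage_add_right ν (y k) B
  simp_rw [h]
  simp

lemma integrable_visit (hB : MeasurableSet B) (hνB : ν B ≠ ∞) (k : Fin n) :
    Integrable (visit B k) (ν.prod μ) := by
  have hm : MeasurableSet {z : E × (Fin n → E) | z.1 + z.2 k ∈ B} :=
    measurable_add_displacement k hB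
  have h : visit B k = {z : E × (Fin n → E) | z.1 + z.2 k ∈ B}.indicator fun _ => (1 : ℝ) := by
    funext z
    by_cases hz : z.1 + z.2 k ∈ B <;> simp [visit, hz]
  rw [h, integrable_indicator_iff hm]
  exact integrableOn_const (by rwa [prod_apply_visit hB])

lemma prod_patternSet_ne_top (hB : MeasurableSet B) (hνB : ν B ≠ ∞) {π : Finset (Fin n)}
    (hπ : π.Nonempty) : (ν.prod μ) (patternSet B π) ≠ ∞ := by
  obtain ⟨k, hk⟩ := hπ
  refine ((measure_mono fun z hz => ?_).trans_lt
    ((prod_apply_visit (ν := ν) (μ := μ) hB k).trans_lt hνB.lt_top)).ne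
  exact hz.1 k hk

lemma integral_exp_sum_visit_sub_one (hB : MeasurableSet B) (hνB : ν B ≠ ∞) (θ : Fin n → ℝ) :
    ∫ z, (Real.exp (∑ k, θ k * visit B k z) - 1) ∂(ν.prod μ) =
      ∑ π : Finset (Fin n) with π.Nonempty,
        (Real.exp (∑ k ∈ π, θ k) - 1) * (ν.prod μ).real (patternSet B π) := by
  simp_rw [exp_sum_visit_sub_one]
  rw [integral_finsetSum]
  · refine Finset.sum_congr rfl fun π _ => ?_
    rw [integral_const_mul, integral_indicator (measurableSet_patternSet hB π)]
    simp
  · intro π hπ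
    exact ((integrable_indicator_iff (measurableSet_patternSet hB π)).2 (integrableOn_const
      (prod_patternSet_ne_top hB hνB (Finset.mem_filter.1 hπ).2))).const_mul _

lemma Q_eq_measureReal {Ω' : Type*} [MeasurableSpace Ω'] {P' : Measure Ω'}
    {Y' : ℝ≥0 → Ω' → E} (hY' : ∀ s, Measurable (Y' s)) (hB : MeasurableSet B) (t : Fin n → ℝ≥0)
    (π : Finset (Fin n)) (x : E) :
    Q P' Y' B t π x =
      (P'.map fun ω k => Y' (t k) ω).real (Prod.mk x ⁻¹' patternSet B π) := by
  rw [map_measureReal_apply (measurable_pi_lambda _ fun k => hY' _)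
    (measurable_prodMk_left (measurableSet_patternSet hB π))]
  rfl

lemma integrable_Q {Ω' : Type*} [MeasurableSpace Ω'] {P' : Measure Ω'} [IsProbabilityMeasure P']
    {Y' : ℝ≥0 → Ω' → E} (hY' : ∀ s, Measurable (Y' s)) (hB : MeasurableSet B) (hνB : ν B ≠ ∞)
    (t : Fin n → ℝ≥0) {π : Finset (Fin n)} (hπ : π.Nonempty) :
    Integrable (fun x => Q P' Y' B t π x) ν := by
  have := Measure.isProbabilityMeasure_map (μ := P')
    (measurable_pi_lambda (fun ω k => Y' (t k) ω) fun k => hY' _).aemeasurable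
  simp_rw [Q_eq_measureReal hY' hB]
  exact Measure.integrable_measure_prodMk_left (measurableSet_patternSet hB π)
    (prod_patternSet_ne_top hB hνB hπ)

lemma integral_Q {Ω' : Type*} [MeasurableSpace Ω'] {P' : Measure Ω'} [IsProbabilityMeasure P']
    {Y' : ℝ≥0 → Ω' → E} (hY' : ∀ s, Measurable (Y' s)) (hB : MeasurableSet B) (hνB : ν B ≠ ∞)
    (t : Fin n → ℝ≥0) {π : Finset (Fin n)} (hπ : π.Nonempty) :
    ∫ x, Q P' Y' B t π x ∂ν =
      (ν.prod (P'.map fun ω k => Y' (t k) ω)).real (patternSet B π) := by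
  have := Measure.isProbabilityMeasure_map (μ := P')
    (measurable_pi_lambda (fun ω k => Y' (t k) ω) fun k => hY' _).aemeasurable
  have hm := measurableSet_patternSet hB π
  have hi : Integrable ((patternSet B π).indicator fun _ => (1 : ℝ))
      (ν.prod (P'.map fun ω k => Y' (t k) ω)) :=
    (integrable_indicator_iff hm).2 (integrableOn_const (prod_patternSet_ne_top hB hνB hπ))
  simp_rw [Q_eq_measureReal hY' hB]
  have h1 := integral_prod _ hi
  rw [integral_indicator hm] at h1
  simp only [integral_const, smul_eq_mul, mul_one, measureReal_restrict_apply_univ] at h1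
  rw [h1]
  congr with x
  exact (integral_indicator_one (measurable_prodMk_left hm)).symm

end Pattern

end Smoluchowski

open Smoluchowski in
theorem mainTheorem1
    {d : ℕ} {Ω Ω' : Type*} [MeasurableSpace Ω] [MeasurableSpace Ω']
    -- the probability space of the particle system, and that of the generic displacement process
    (P : Measure Ω) [IsProbabilityMeasure P] (P' : Measure Ω') [IsProbabilityMeasure P']
    -- the initial positions form a homogeneous Poisson process with rate `lam`
    (lam : ℝ) (hlam : 0 < lam)
    (ξ : ℤ → Ω → EuclideanSpace ℝ (Fin d)) (hξ : ∀ j, Measurable (ξ j))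
    (hΞ : Smoluchowski.IsPoissonProcess (Smoluchowski.pointConfiguration ξ)
      (ENNReal.ofReal lam • (volume : Measure (EuclideanSpace ℝ (Fin d)))) P)
    -- the generic displacement process
    (Y' : ℝ≥0 → Ω' → EuclideanSpace ℝ (Fin d)) (hY' : ∀ s, Measurable (Y' s))
    (hY'0 : ∀ᵐ ω ∂P', Y' 0 ω = 0)
    -- its independent copies, independent of the initial positions
    (Y : ℤ → ℝ≥0 → Ω → EuclideanSpace ℝ (Fin d)) (hY : ∀ j s, Measurable (Y j s))
    (hYlaw : ∀ j, IdentDistrib (fun ω s => Y j s ω) (fun ω s => Y' s ω) P P')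
    (hYindep : iIndepFun (fun (j : ℤ) (ω : Ω) (s : ℝ≥0) => Y j s ω) P)
    (hξY : IndepFun (fun (ω : Ω) (j : ℤ) => ξ j ω)
      (fun (ω : Ω) (j : ℤ) (s : ℝ≥0) => Y j s ω) P)
    -- the observation region
    (B : Set (EuclideanSpace ℝ (Fin d))) (hB : IsCompact B) (hBint : (interior B).Nonempty)
    (n : ℕ) (θ : Fin n → ℝ) (t : Fin n → ℝ≥0) (ht : Monotone t) :
    (∀ k, ∀ᵐ ω ∂P, Smoluchowski.smoluchowski ξ Y B (t k) ω ≠ ∞) ∧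
    (∀ π : Finset (Fin n), π.Nonempty →
      Integrable (fun x => Smoluchowski.Q P' Y' B t π x) volume) ∧
    Integrable (fun ω =>
      Real.exp (∑ k, θ k * (Smoluchowski.smoluchowski ξ Y B (t k) ω).toReal)) P ∧
    Real.log (∫ ω,
        Real.exp (∑ k, θ k * (Smoluchowski.smoluchowski ξ Y B (t k) ω).toReal) ∂P) =
      lam * ∑ π : Finset (Fin n) with π.Nonempty,
        (Real.exp (∑ k ∈ π, θ k) - 1) * Smoluchowski.Qbar P' Y' B t π := by
  have hBm : MeasurableSet B := hB.measurableSet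
  have hvB : volume B ≠ ∞ := hB.measure_lt_top.ne
  set ν : Measure (EuclideanSpace ℝ (Fin d)) := ENNReal.ofReal lam • volume with hν
  have : SigmaFinite ν := SMul.sigmaFinite lam.toNNReal
  have hνB : ν B ≠ ∞ := ENNReal.mul_ne_top ENNReal.ofReal_ne_top hvB
  -- the displacements at the observation times serve as marks
  let W : ℤ → Ω → Fin n → EuclideanSpace ℝ (Fin d) := fun j ω k => Y j (t k) ω
  let μ : Measure (Fin n → EuclideanSpace ℝ (Fin d)) := P'.map fun ω k => Y' (t k) ω
  have : IsProbabilityMeasure μ := Measure.isProbabilityMeasure_map (μ := P')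
    (measurable_pi_lambda (fun ω k => Y' (t k) ω) fun k => hY' _).aemeasurable
  have hW : ∀ j, Measurable (W j) := fun j => measurable_pi_lambda _ fun k => hY j _
  have hsamp : Measurable fun (y : ℝ≥0 → EuclideanSpace ℝ (Fin d)) (k : Fin n) => y (t k) := by
    fun_prop
  have hWlaw : ∀ j, P.map (W j) = μ := fun j => ((hYlaw j).comp hsamp).map_eq
  have hWind : iIndepFun W P := hYindep.comp (fun _ y k => y (t k)) fun _ => hsamp
  have hξW : IndepFun (fun ω j => ξ j ω) (fun ω j => W j ω) P :=
    hξY.comp (φ := id)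
      (ψ := fun (y : ℤ → ℝ≥0 → EuclideanSpace ℝ (Fin d)) j (k : Fin n) => y j (t k))
      measurable_id (by fun_prop)
  have hvis : ∀ k, Integrable (visit B k) (ν.prod μ) := fun k => integrable_visit hBm hνB k
  have hN : ∀ k, ∀ᵐ ω ∂P, smoluchowski ξ Y B (t k) ω ≠ ∞ ∧
      HasSum (fun j => visit B k (ξ j ω, W j ω)) (smoluchowski ξ Y B (t k) ω).toReal := by
    intro k
    filter_upwards [hΞ.ae_summable_abs_mark hξ hW hWlaw hξW (measurable_visit hBm k) (hvis k)]
      with ω hω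
    have h0 : ∀ j, 0 ≤ visit B k (ξ j ω, W j ω) := fun j =>
      Set.indicator_nonneg (fun _ _ => zero_le_one) _
    have h1 : smoluchowski ξ Y B (t k) ω = ENNReal.ofReal (∑' j, visit B k (ξ j ω, W j ω)) := by
      rw [ENNReal.ofReal_tsum_of_nonneg h0 (Summable.of_abs hω)]
      refine tsum_congr fun j => ?_
      by_cases hj : ξ j ω + Y j (t k) ω ∈ B <;> simp [visit, location, W, hj]
    refine ⟨h1 ▸ ENNReal.ofReal_ne_top, ?_⟩
    rw [h1, ENNReal.toReal_ofReal (tsum_nonneg h0)]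
    exact (Summable.of_abs hω).hasSum
  have hexp : (fun ω => Real.exp (∑ k, θ k * (smoluchowski ξ Y B (t k) ω).toReal)) =ᵐ[P]
      fun ω => Real.exp (∑' j, ∑ k, θ k * visit B k (ξ j ω, W j ω)) := by
    filter_upwards [ae_all_iff.2 hN] with ω hω
    rw [(hasSum_sum fun k (_ : k ∈ Finset.univ) => (hω k).2.mul_left (θ k)).tsum_eq]
  have hbound : ∀ z : EuclideanSpace ℝ (Fin d) × (Fin n → EuclideanSpace ℝ (Fin d)),
      |∑ k, θ k * visit B k z| ≤ ∑ k, |θ k| := fun z => by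
    refine (Finset.abs_sum_le_sum_abs _ _).trans (Finset.sum_le_sum fun k _ => ?_)
    by_cases hk : z.1 + z.2 k ∈ B <;> simp [visit, hk]
  have hmain := hΞ.integral_exp_tsum_mark hξ hW hWlaw hWind hξW
    (g := fun z => ∑ k, θ k * visit B k z)
    (Finset.measurable_fun_sum _ fun k _ => (measurable_visit hBm k).const_mul _)
    (integrable_finsetSum _ fun k _ => (hvis k).const_mul _) hbound
  refine ⟨fun k => (hN k).mono fun ω hω => hω.1, fun π hπ => integrable_Q hY' hBm hvB t hπ,
    hmain.1.congr hexp.symm, ?_⟩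
  rw [integral_congr_ae hexp, hmain.2, Real.log_exp, integral_exp_sum_visit_sub_one hBm hνB,
    Finset.mul_sum]
  refine Finset.sum_congr rfl fun π hπ => ?_
  rw [Qbar, integral_Q hY' hBm hvB t (Finset.mem_filter.1 hπ).2, hν, Measure.prod_smul_left,
    measureReal_ennreal_smul_apply, ENNReal.toReal_ofReal hlam.le]
  ring
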